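/- Let $d\in\{0,1,2,\dots\}\cup\{\infty\}$ (with $d=\infty$ meaning countably many variables), and let $\mathbb F_d^+$ be the set of all finite words (including the empty word) in $d$ letters. A free power series is a formal sum $F(X)=\sum_{\alpha\in\mathbb F_d^+}c_\alpha X^\alpha$, where $X^\alpha=X_{i_1}\cdots X_{i_k}$ for $\alpha=i_1\cdots i_k$ and $X^\varnothing=I$; free power series are multiplied by the Cauchy product $(FG)_\alpha=\sum_{\beta\gamma=\alpha}F_\beta G_\gamma$. The free unit ball $\mathcal B_d$ consists of all $d$-tuples $X=(X_j)$ of complex $n\times n$ matrices, over all sizes $n$, with $\|\sum_j X_jX_j^*\|<1$ (operator norm; for $d=\infty$ the series is required to converge). $F$ is free holomorphic if $\sum_{k}\big\|\sum_{|\alpha|=k}c_\alpha X^\alpha\big\|<\infty$ for all $X\in\mathcal B_d$ (for $d=\infty$ the inner sums are required to converge unconditionally); then $F(X)=\sum_k\sum_{|\alpha|=k}c_\alpha X^\alpha$. It is bounded, $F\in\mathfrak F^\infty_d$, if moreover $\sup_{X\in\mathcal B_d}\|F(X)\|<\infty$. The Fock space $\mathfrak F^2_d$ is the Hilbert space of free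 power series with $\|F\|^2=\sum_\alpha|c_\alpha|^2<\infty$. A function $A\in\mathfrak F^\infty_d$ is left outer if $G\mapsto AG$ is a bounded operator on $\mathfrak F^2_d$ with dense range. A column $(\Phi_k)_k$ of functions in $\mathfrak F_d^\infty$ is an isometric left multiplier if $G\mapsto(\Phi_kG)_k$ is an isometry from $\mathfrak F^2_d$ into the Hilbert space direct sum $\bigoplus_k\mathfrak F^2_d$. **Proposition.** Let $(H_i)_{i\ge1}$ be a sequence in $\mathfrak F^2_d$ with $\sum_{i=1}^\infty\|H_i\|^2<\infty$. Then there exist a free function $A$ and a sequence of free functions $B_1,B_2,\dots$ in $\mathfrak F^\infty_d$ such that: 1. $A$ is left outer; 2. for every $X\in\mathcal B_d$ the matrix $A(X)$ is invertible, and $H_i(X)=B_i(X)A(X)^{-1}$ for every $i$; 3. the column $(A,B_1,B_2,\dots)^{T}$ is an isometric left multiplier; 4. $A^{-1}\in\mathfrak F^2_d$, that is, there is $C\in\mathfrak F^2_d$ with $C(X)=A(X)^{-1}$ for all $X\in\mathcal B_d$, and $\|A^{-1}\|^2_{\mathfrak F^2_d}=\|C\|^2_{\mathfrak F^2_d}=1+\sum_{i=1}^\infty\|H_i\|^2_{\mathfrak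 F^2_d}$. -/

import Mathlib

namespace FreeFock

open scoped Matrix.Norms.L2Operator

/-- A free (noncommutative) power series `∑ c_α X^α` in variables indexed by `ι`, given by its
coefficients. Words in the letters `ι`, i.e. elements of the free semigroup with the empty word,
are lists. -/
abbrev FreeSeries (ι : Type*) : Type _ := List ι → ℂ

/-- The Fock space: free power series with square-summable coefficients, with the `ℓ²` norm. -/
abbrev FockSpace (ι : Type*) : Type _ := lp (fun _ : List ι => ℂ) 2

/-- The Cauchy product: the coefficient at `α` is the sum of `f_β g_γ` over all factorizations
`α = βγ`, which are `β = α.take k`, `γ = α.drop k` for `0 ≤ k ≤ |α|`. -/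
def cauchyProd {ι : Type*} (F G : FreeSeries ι) : FreeSeries ι :=
  fun α => ∑ k ∈ Finset.range (α.length + 1), F (α.take k) * G (α.drop k)

/-- The `n × n` level of the free unit ball: tuples with `‖∑ X_j X_j^*‖ < 1`
(the norm is the operator norm; for infinitely many variables the series has to converge). -/
def freeBall (ι : Type*) (n : ℕ) : Set (ι → Matrix (Fin n) (Fin n) ℂ) :=
  {X | Summable (fun j => X j * (X j).conjTranspose) ∧
    ‖∑' j, X j * (X j).conjTranspose‖ < 1}

/-- The monomial `X^α = X_{i₁} X_{i₂} ⋯ X_{iₖ}`, with `X^∅ = 1`. -/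
def wordEval {ι : Type*} {n : ℕ} (X : ι → Matrix (Fin n) (Fin n) ℂ) (α : List ι) :
    Matrix (Fin n) (Fin n) ℂ :=
  (α.map X).prod

/-- The homogeneous part `∑_{|α| = k} c_α X^α`. -/
noncomputable def homogPart {ι : Type*} {n : ℕ} (F : FreeSeries ι) (k : ℕ)
    (X : ι → Matrix (Fin n) (Fin n) ℂ) : Matrix (Fin n) (Fin n) ℂ :=
  ∑' α : {α : List ι // α.length = k}, F α.1 • wordEval X α.1

/-- The value `F(X) = ∑_k ∑_{|α| = k} c_α X^α`. -/
noncomputable def eval {ι : Type*} {n : ℕ} (F : FreeSeries ι)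
    (X : ι → Matrix (Fin n) (Fin n) ℂ) : Matrix (Fin n) (Fin n) ℂ :=
  ∑' k : ℕ, homogPart F k X

/-- Free holomorphic functions in the free unit ball: `∑_k ‖∑_{|α| = k} c_α X^α‖` converges for
every point `X` of the ball, of any matrix size (each homogeneous part being itself convergent). -/
def IsFreeHolomorphic {ι : Type*} (F : FreeSeries ι) : Prop :=
  ∀ (n : ℕ), ∀ X ∈ freeBall ι n,
    (∀ k : ℕ, Summable (fun α : {α : List ι // α.length = k} => F α.1 • wordEval X α.1)) ∧
      Summable (fun k : ℕ => ‖homogPart F k X‖)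

/-- The bounded free holomorphic functions, i.e. those with `sup ‖F(X)‖ < ∞` over the whole free
unit ball (all matrix sizes). -/
def IsBoundedFree {ι : Type*} (F : FreeSeries ι) : Prop :=
  IsFreeHolomorphic F ∧ ∃ C : ℝ, ∀ (n : ℕ), ∀ X ∈ freeBall ι n, ‖eval F X‖ ≤ C

/-- `A` is left outer: it is a bounded free function, and left multiplication `G ↦ AG` is a bounded
operator on the Fock space with dense range. -/
def IsLeftOuter {ι : Type*} (A : FreeSeries ι) : Prop :=
  IsBoundedFree A ∧ ∃ M : FockSpace ι →L[ℂ] FockSpace ι,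
    (∀ G : FockSpace ι, (⇑(M G) : FreeSeries ι) = cauchyProd A ⇑G) ∧ DenseRange M

/-- The column with entries `Φ k` is an isometric left multiplier: the entries are bounded free
functions, and `G ↦ (Φ k G)_k` is a linear isometry of the Fock space into the Hilbert space direct
sum of copies of the Fock space indexed by `κ`. -/
def IsIsometricLeftColumn {ι κ : Type*} (Φ : κ → FreeSeries ι) : Prop :=
  (∀ k, IsBoundedFree (Φ k)) ∧
    ∃ V : FockSpace ι →ₗᵢ[ℂ] lp (fun _ : κ => FockSpace ι) 2,
      ∀ (G : FockSpace ι) (k : κ), (⇑(V G k) : FreeSeries ι) = cauchyProd (Φ k) ⇑G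

end FreeFock

namespace FreeFock

/-! ### Beurling–Wold decomposition for a cyclic invariant subspace of a free shift. -/

section Wold

variable {ι E : Type*} [NormedAddCommGroup E] [InnerProductSpace ℂ E]

/-! Put `h = (1, H₁, H₂, …)` in a direct sum of Fock spaces. Right translations act there as a free
shift and commute with left multiplication. The constant term of the first entry keeps `h` out of
the closed span of its proper translates, so the normalized component `φ` of `h` orthogonal to that
span exists. The translates of `φ` are orthonormal and their closed span contains that of the
translates of `h` (`IsShift.exists_wandering`).

Hence `V : G ↦ (φ_k G)_k` is an isometry (`wanderingIsometry_apply`) whose range contains every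
translate of `h`. Take `A`, `B_i` to be the entries of `φ`, and `C` with `V C = h`. Then `AC = 1`,
`B_i C = H_i` and `‖C‖ = ‖h‖`, which is the norm formula. The range of left multiplication by `A`
contains the first entry of each translate of `h`, that is, every monomial; so `A` is outer.

Two analytic facts turn this into statements about values at matrices. Square-summable series
converge absolutely on the ball, so evaluation is multiplicative (`eval_mul_eval`); and bounded left
multipliers have bounded values, by a Poisson kernel argument (`norm_eval_le`). -/

theorem closure_span_le {s : Set E} {K : Submodule ℂ E} (hK : IsClosed (K : Set E))
    (h : ∀ x ∈ s, x ∈ K) : (Submodule.span ℂ s).topologicalClosure ≤ K :=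
  Submodule.topologicalClosure_minimal _ (Submodule.span_le.2 h) hK

theorem subset_closure_span {s : Set E} {x : E} (hx : x ∈ s) :
    x ∈ (Submodule.span ℂ s).topologicalClosure :=
  Submodule.le_topologicalClosure _ (Submodule.subset_span hx)

/-- A representation by isometries of the free semigroup (acting on the right), such that different
letters have orthogonal ranges, and whose vacuum vectors `S` are orthogonal to the ranges of the
letters and generate the space. -/
structure IsShift (T : List ι → E →ₗᵢ[ℂ] E) (S : Set E) : Prop where
  nil : ∀ x, T [] x = x
  append : ∀ α β x, T (α ++ β) x = T β (T α x)
  orthogonal : ∀ i j, i ≠ j → ∀ x y, inner ℂ (T [i] x) (T [j] y) = 0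
  vacuum : ∀ s ∈ S, ∀ j x, inner ℂ s (T [j] x) = 0
  total : ∀ g, (∀ s ∈ S, ∀ α, inner ℂ (T α s) g = 0) → g = 0

/-- The closed invariant subspace generated by `h`. -/
def cyclicSpan (T : List ι → E →ₗᵢ[ℂ] E) (h : E) : Submodule ℂ E :=
  (Submodule.span ℂ (Set.range fun α => T α h)).topologicalClosure

/-- The closed span of the proper translates of `h`. -/
def properSpan (T : List ι → E →ₗᵢ[ℂ] E) (h : E) : Submodule ℂ E :=
  (Submodule.span ℂ ((fun α => T α h) '' {α | α ≠ []})).topologicalClosure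

theorem isClosed_cyclicSpan (T : List ι → E →ₗᵢ[ℂ] E) (h : E) :
    IsClosed (cyclicSpan T h : Set E) := Submodule.isClosed_topologicalClosure _

theorem isClosed_properSpan (T : List ι → E →ₗᵢ[ℂ] E) (h : E) :
    IsClosed (properSpan T h : Set E) := Submodule.isClosed_topologicalClosure _

theorem properSpan_le (T : List ι → E →ₗᵢ[ℂ] E) (h : E) : properSpan T h ≤ cyclicSpan T h :=
  closure_span_le (isClosed_cyclicSpan T h) (by
    rintro _ ⟨α, -, rfl⟩
    exact subset_closure_span ⟨α, rfl⟩)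

theorem isClosed_comap {F : Type*} [NormedAddCommGroup F] [InnerProductSpace ℂ F]
    {K : Submodule ℂ F} (hK : IsClosed (K : Set F)) (f : E →L[ℂ] F) :
    IsClosed (K.comap (f : E →ₗ[ℂ] F) : Set E) := hK.preimage f.continuous

variable {T : List ι → E →ₗᵢ[ℂ] E} {S : Set E}

theorem IsShift.map_mem_properSpan (hT : IsShift T S) {h x : E} (hx : x ∈ cyclicSpan T h)
    {α : List ι} (hα : α ≠ []) : T α x ∈ properSpan T h := by
  have : cyclicSpan T h ≤ (properSpan T h).comap
      ((T α).toContinuousLinearMap : E →ₗ[ℂ] E) := by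
    refine closure_span_le (isClosed_comap (isClosed_properSpan T h) _) ?_
    rintro _ ⟨β, rfl⟩
    exact subset_closure_span ⟨β ++ α, by simp [hα], hT.append _ _ _⟩
  exact this hx

theorem IsShift.inner_vacuum (hT : IsShift T S) {h s x : E} (hs : s ∈ S)
    (hx : x ∈ properSpan T h) : inner ℂ s x = 0 := by
  have : properSpan T h ≤ (ℂ ∙ s)ᗮ := by
    refine closure_span_le (Submodule.isClosed_orthogonal _) ?_
    rintro _ ⟨α, hα, rfl⟩
    rw [Submodule.mem_orthogonal_singleton_iff_inner_right]
    obtain ⟨β, j, rfl⟩ := (List.eq_nil_or_concat' α).resolve_left hα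
    simp only [hT.append]
    exact hT.vacuum s hs j _
  exact (Submodule.mem_orthogonal_singleton_iff_inner_right).1 (this hx)

/-- Compare last letters: distinct ones give orthogonal ranges, equal ones cancel by isometry. When
one word runs out, the wandering condition `h0` applies. -/
theorem IsShift.orthonormal (hT : IsShift T S) {φ : E} (h1 : ‖φ‖ = 1)
    (h0 : ∀ α, α ≠ [] → inner ℂ φ (T α φ) = 0) : Orthonormal ℂ fun α => T α φ := by
  refine ⟨fun α => by simpa using h1, ?_⟩
  intro α
  induction α using List.reverseRecOn with
  | nil =>
    intro β hβ
    simpa [hT.nil] using h0 β (Ne.symm hβ)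
  | append_singleton α i ih =>
    intro β hβ
    rcases List.eq_nil_or_concat' β with rfl | ⟨β, j, rfl⟩
    · simpa [hT.nil] using inner_eq_zero_symm.1 (h0 (α ++ [i]) (by simp))
    · simp only [hT.append]
      by_cases hij : i = j
      · subst hij
        rw [LinearIsometry.inner_map_map]
        exact ih (by rintro rfl; exact hβ rfl)
      · exact hT.orthogonal i j hij _ _

variable [CompleteSpace E]

/-- The backward shift by `j` deletes a last letter `j` and kills words ending in another letter. -/
theorem IsShift.adjoint_mem (hT : IsShift T S) {h x : E} (hx : x ∈ properSpan T h) (j : ι) :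
    ContinuousLinearMap.adjoint (T [j]).toContinuousLinearMap x ∈ cyclicSpan T h := by
  have : properSpan T h ≤ (cyclicSpan T h).comap
      (ContinuousLinearMap.adjoint (T [j]).toContinuousLinearMap : E →ₗ[ℂ] E) := by
    refine closure_span_le (isClosed_comap (isClosed_cyclicSpan T h) _) ?_
    rintro _ ⟨α, hα, rfl⟩
    obtain ⟨β, i, rfl⟩ := (List.eq_nil_or_concat' α).resolve_left hα
    simp only [hT.append, Submodule.mem_comap, ContinuousLinearMap.coe_coe]
    by_cases hij : j = i
    · subst hij
      have : ContinuousLinearMap.adjoint (T [j]).toContinuousLinearMap (T [j] (T β h)) = T β h := by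
        refine ext_inner_left ℂ fun v => ?_
        rw [ContinuousLinearMap.adjoint_inner_right]
        exact (T [j]).inner_map_map _ _
      rw [this]
      exact subset_closure_span ⟨β, rfl⟩
    · have : ContinuousLinearMap.adjoint (T [j]).toContinuousLinearMap (T [i] (T β h)) = 0 := by
        refine ext_inner_left ℂ fun v => ?_
        rw [ContinuousLinearMap.adjoint_inner_right, inner_zero_right]
        exact hT.orthogonal j i hij _ _
      rw [this]
      exact zero_mem _
  exact this hx

/-- Orthogonality to `φ` pushes `g` into the proper span, where it has no vacuum component. Its
backward shifts lie again in the cyclic span and are again orthogonal to all translates of `φ`.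
Iterating, every coefficient of `g` vanishes. -/
theorem IsShift.eq_zero_of_inner_eq_zero (hT : IsShift T S) {h φ : E}
    (hφ : φ ∈ (properSpan T h)ᗮ) (hh : ∃ c : ℂ, h - c • φ ∈ properSpan T h)
    {g : E} (hg : g ∈ cyclicSpan T h) (hgφ : ∀ α, inner ℂ (T α φ) g = 0) : g = 0 := by
  -- The component `u` of `g` off the proper span is orthogonal to the proper translates of `h` and,
  -- since `h ∈ cφ + properSpan T h`, to `h` itself; hence `u` is orthogonal to itself.
  have key : ∀ g ∈ cyclicSpan T h, inner ℂ φ g = 0 → g ∈ properSpan T h := by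
    intro g hg hgφ
    have : CompleteSpace (properSpan T h) := (isClosed_properSpan T h).completeSpace_coe
    set u := g - (properSpan T h).starProjection g with hu
    have hP : (properSpan T h).starProjection g ∈ properSpan T h :=
      Submodule.starProjection_apply_mem _ _
    have huN : u ∈ (properSpan T h)ᗮ := Submodule.sub_starProjection_mem_orthogonal _
    have huM : u ∈ cyclicSpan T h := sub_mem hg (properSpan_le T h hP)
    have huφ : inner ℂ φ u = 0 := by
      rw [hu, inner_sub_right, hgφ, Submodule.inner_left_of_mem_orthogonal hP hφ, sub_zero]
    have : cyclicSpan T h ≤ (ℂ ∙ u)ᗮ := by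
      refine closure_span_le (Submodule.isClosed_orthogonal _) ?_
      rintro _ ⟨α, rfl⟩
      rw [Submodule.mem_orthogonal_singleton_iff_inner_left]
      by_cases hα : α = []
      · obtain ⟨c, hc⟩ := hh
        have h1 := Submodule.inner_right_of_mem_orthogonal hc huN
        rw [inner_sub_left, inner_smul_left, huφ, mul_zero, sub_zero] at h1
        simpa [hα, hT.nil] using h1
      · have hα' : T α h ∈ properSpan T h := subset_closure_span ⟨α, hα, rfl⟩
        exact Submodule.inner_right_of_mem_orthogonal hα' huN
    have hu0 : u = 0 := by
      have := this huM
      rw [Submodule.mem_orthogonal_singleton_iff_inner_left] at this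
      exact inner_self_eq_zero.1 this
    rw [sub_eq_zero.1 hu0]
    exact hP
  refine hT.total g fun s hs α => ?_
  induction α using List.reverseRecOn generalizing g with
  | nil =>
    rw [hT.nil]
    exact hT.inner_vacuum hs (key g hg (by simpa [hT.nil] using hgφ []))
  | append_singleton α j ih =>
    have hgN := key g hg (by simpa [hT.nil] using hgφ [])
    rw [hT.append, ← LinearIsometry.coe_toContinuousLinearMap,
      ← ContinuousLinearMap.adjoint_inner_right]
    refine ih (hT.adjoint_mem hgN j) fun β => ?_
    rw [ContinuousLinearMap.adjoint_inner_right]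
    have := hgφ (β ++ [j])
    rwa [hT.append] at this

/-- Beurling–Wold: a cyclic invariant subspace of a shift, whose generator is not orthogonal to the
vacuum, is generated by a wandering unit vector. -/
theorem IsShift.exists_wandering (hT : IsShift T S) (h : E) (hh : ∃ s ∈ S, inner ℂ s h ≠ 0) :
    ∃ φ : E, Orthonormal ℂ (fun α => T α φ) ∧
      cyclicSpan T h ≤ (Submodule.span ℂ (Set.range fun α => T α φ)).topologicalClosure := by
  have : CompleteSpace (properSpan T h) := (isClosed_properSpan T h).completeSpace_coe
  set u := h - (properSpan T h).starProjection h with hu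
  have hP : (properSpan T h).starProjection h ∈ properSpan T h :=
    Submodule.starProjection_apply_mem _ _
  have huN : u ∈ (properSpan T h)ᗮ := Submodule.sub_starProjection_mem_orthogonal _
  have hhM : h ∈ cyclicSpan T h := subset_closure_span ⟨[], hT.nil h⟩
  have huM : u ∈ cyclicSpan T h := sub_mem hhM (properSpan_le T h hP)
  have hu0 : u ≠ 0 := by
    intro h0
    obtain ⟨s, hs, hsh⟩ := hh
    rw [sub_eq_zero.1 h0] at hsh
    exact hsh (hT.inner_vacuum hs hP)
  set φ : E := ((‖u‖⁻¹ : ℝ) : ℂ) • u with hφ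
  have hφM : φ ∈ cyclicSpan T h := Submodule.smul_mem _ _ huM
  have hφN : φ ∈ (properSpan T h)ᗮ := Submodule.smul_mem _ _ huN
  have hφ1 : ‖φ‖ = 1 := by
    rw [hφ, norm_smul]
    simp [hu0]
  refine ⟨φ, hT.orthonormal hφ1 fun α hα =>
    Submodule.inner_left_of_mem_orthogonal (hT.map_mem_properSpan hφM hα) hφN, ?_⟩
  set K := (Submodule.span ℂ (Set.range fun α => T α φ)).topologicalClosure with hK
  have hKc : IsClosed (K : Set E) := Submodule.isClosed_topologicalClosure _
  have : CompleteSpace K := hKc.completeSpace_coe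
  have hKM : K ≤ cyclicSpan T h := by
    refine closure_span_le (isClosed_cyclicSpan T h) ?_
    rintro _ ⟨α, rfl⟩
    by_cases hα : α = []
    · simpa [hα, hT.nil] using hφM
    · exact properSpan_le T h (hT.map_mem_properSpan hφM hα)
  intro g hg
  have h0 : g - K.starProjection g = 0 := by
    -- The scalar `‖u‖` undoes the normalization: `h - ‖u‖ • φ = h - u` is the projection of `h`
    -- onto the proper span.
    refine hT.eq_zero_of_inner_eq_zero hφN ⟨(‖u‖ : ℂ), ?_⟩
      (sub_mem hg (hKM (Submodule.starProjection_apply_mem _ _))) fun α => ?_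
    rotate_left
    · have hα : T α φ ∈ K := subset_closure_span ⟨α, rfl⟩
      exact Submodule.inner_right_of_mem_orthogonal hα
        (Submodule.sub_starProjection_mem_orthogonal _)
    have : (‖u‖ : ℂ) • φ = u := by
      rw [hφ, smul_smul]
      have : (‖u‖ : ℂ) ≠ 0 := by simpa using hu0
      simp [this]
    rw [this, hu, sub_sub_cancel]
    exact hP
  rw [sub_eq_zero.1 h0]
  exact Submodule.starProjection_apply_mem _ _

/-- The isometry that sends the basis vector `e_α` to `T α φ`. -/
noncomputable def wanderingIsometry {φ : E} (h : Orthonormal ℂ fun α => T α φ) :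
    FockSpace ι →ₗᵢ[ℂ] E :=
  h.orthogonalFamily.linearIsometry

theorem hasSum_wanderingIsometry {φ : E} (h : Orthonormal ℂ fun α => T α φ) (G : FockSpace ι) :
    HasSum (fun α => G α • T α φ) (wanderingIsometry h G) := by
  simpa [wanderingIsometry] using h.orthogonalFamily.hasSum_linearIsometry G

theorem closure_span_le_range {φ : E} (h : Orthonormal ℂ fun α => T α φ) :
    (Submodule.span ℂ (Set.range fun α => T α φ)).topologicalClosure ≤
      LinearMap.range (wanderingIsometry h).toLinearMap := by
  classical
  refine closure_span_le
    (wanderingIsometry h).isometry.isUniformInducing.isComplete_range.isClosed ?_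
  rintro _ ⟨α, rfl⟩
  refine ⟨lp.single 2 α 1, ?_⟩
  simp [wanderingIsometry]

end Wold

end FreeFock

namespace FreeFock

/-! ### Right translations on Fock spaces and their link with the Cauchy product. -/

section Translation

variable {ι κ : Type*}

theorem norm_sq_eq_tsum {G : κ → Type*} [∀ k, NormedAddCommGroup (G k)] (f : lp G 2) :
    ‖f‖ ^ 2 = ∑' k, ‖f k‖ ^ 2 := by
  simpa using lp.norm_rpow_eq_tsum (p := 2) (by norm_num) f

theorem summable_norm_sq {G : κ → Type*} [∀ k, NormedAddCommGroup (G k)] (f : lp G 2) :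
    Summable fun k => ‖f k‖ ^ 2 := by
  simpa using (lp.memℓp f).summable (by norm_num)

theorem memℓp_two {G : κ → Type*} [∀ k, NormedAddCommGroup (G k)] {f : ∀ k, G k}
    (h : Summable fun k => ‖f k‖ ^ 2) : Memℓp f 2 :=
  memℓp_gen (by simpa using h)

theorem norm_extend_sq_eq_zero {β : Type*} {f : κ → β} (g : κ → ℂ) {x : β}
    (hx : x ∉ Set.range f) : ‖Function.extend f g 0 x‖ ^ 2 = 0 := by
  rw [Function.extend_apply' _ _ _ hx]; simp

/-- Right translation `e_β ↦ e_{βα}` of the Fock space. -/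
noncomputable def rightTranslate (α : List ι) : FockSpace ι →ₗᵢ[ℂ] FockSpace ι where
  toFun g := ⟨Function.extend (· ++ α) g 0, memℓp_two (by
    rw [← (List.append_left_injective α).summable_iff fun x hx => norm_extend_sq_eq_zero _ hx]
    simpa [Function.comp_def, (List.append_left_injective α).extend_apply]
      using summable_norm_sq g)⟩
  map_add' f g := by
    ext x
    change Function.extend (· ++ α) (fun y => f y + g y) 0 x =
      Function.extend (· ++ α) (⇑f) 0 x + Function.extend (· ++ α) (⇑g) 0 x
    by_cases hx : x ∈ Set.range (· ++ α)
    · obtain ⟨y, rfl⟩ := hx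
      simp [(List.append_left_injective α).extend_apply]
    · simp [Function.extend_apply' _ _ _ hx]
  map_smul' c g := by
    ext x
    by_cases hx : x ∈ Set.range (· ++ α)
    · obtain ⟨y, rfl⟩ := hx
      simp [(List.append_left_injective α).extend_apply]
    · simp [Function.extend_apply' _ _ _ hx]
  norm_map' g := by
    rw [← sq_eq_sq₀ (norm_nonneg _) (norm_nonneg _), norm_sq_eq_tsum, norm_sq_eq_tsum]
    rw [← (List.append_left_injective α).tsum_eq]
    · simp [(List.append_left_injective α).extend_apply]
    · intro x hx
      by_contra h
      exact hx (norm_extend_sq_eq_zero _ h)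

theorem rightTranslate_append (α : List ι) (g : FockSpace ι) (β : List ι) :
    rightTranslate α g (β ++ α) = g β :=
  (List.append_left_injective α).extend_apply _ _ _

theorem rightTranslate_eq_zero (α : List ι) (g : FockSpace ι) {γ : List ι}
    (h : ¬ α <:+ γ) : rightTranslate α g γ = 0 :=
  Function.extend_apply' _ _ _ h

theorem rightTranslate_nil (g : FockSpace ι) : rightTranslate [] g = g := by
  ext x
  simpa using rightTranslate_append [] g x

theorem rightTranslate_comp (α β : List ι) (g : FockSpace ι) :
    rightTranslate (α ++ β) g = rightTranslate β (rightTranslate α g) := by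
  ext x
  by_cases hβ : β <:+ x
  · obtain ⟨y, rfl⟩ := hβ
    rw [rightTranslate_append]
    by_cases hα : α <:+ y
    · obtain ⟨z, rfl⟩ := hα
      rw [rightTranslate_append, List.append_assoc, rightTranslate_append]
    · rw [rightTranslate_eq_zero _ _ hα, rightTranslate_eq_zero]
      rintro ⟨z, hz⟩
      rw [← List.append_assoc] at hz
      exact hα ⟨z, List.append_cancel_right hz⟩
  · rw [rightTranslate_eq_zero _ _ hβ, rightTranslate_eq_zero]
    rintro ⟨z, hz⟩
    exact hβ ⟨z ++ α, by rw [List.append_assoc, hz]⟩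

theorem inner_rightTranslate_of_ne {i j : ι} (h : i ≠ j) (f g : FockSpace ι) :
    inner ℂ (rightTranslate [i] f) (rightTranslate [j] g) = 0 := by
  rw [lp.inner_eq_tsum]
  convert tsum_zero with x
  by_cases hi : [i] <:+ x
  · rw [rightTranslate_eq_zero [j], inner_zero_right]
    obtain ⟨y, rfl⟩ := hi
    rintro ⟨z, hz⟩
    simp at hz
    exact h hz.2.symm
  · rw [rightTranslate_eq_zero _ _ hi, inner_zero_left]

/-- The coordinatewise action of an isometry on a Hilbert space direct sum. -/
noncomputable def coordMap (κ : Type*) {F : Type*} [NormedAddCommGroup F] [NormedSpace ℂ F]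
    (V : F →ₗᵢ[ℂ] F) : lp (fun _ : κ => F) 2 →ₗᵢ[ℂ] lp (fun _ : κ => F) 2 where
  toFun g := ⟨fun k => V (g k), memℓp_two (by simpa using summable_norm_sq g)⟩
  map_add' f g := by ext1; funext k; exact map_add V _ _
  map_smul' c g := by ext1; funext k; exact map_smul V _ _
  norm_map' g := by
    rw [← sq_eq_sq₀ (norm_nonneg _) (norm_nonneg _), norm_sq_eq_tsum, norm_sq_eq_tsum]
    simp

/-- Right translation on a direct sum of Fock spaces. -/
noncomputable def columnTranslate (κ : Type*) (α : List ι) :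
    lp (fun _ : κ => FockSpace ι) 2 →ₗᵢ[ℂ] lp (fun _ : κ => FockSpace ι) 2 :=
  coordMap κ (rightTranslate α)

theorem columnTranslate_apply (α : List ι) (g : lp (fun _ : κ => FockSpace ι) 2) (k : κ) :
    columnTranslate κ α g k = rightTranslate α (g k) := rfl

open Classical in
/-- The constant columns with one nonzero entry, equal to `1`. -/
noncomputable def vacuum (ι κ : Type*) (k : κ) : lp (fun _ : κ => FockSpace ι) 2 :=
  lp.single 2 k (lp.single 2 [] 1)

theorem inner_vacuum_left (k : κ) (g : lp (fun _ : κ => FockSpace ι) 2) :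
    inner ℂ (vacuum ι κ k) g = g k [] := by
  classical
  rw [vacuum, lp.inner_single_left, lp.inner_single_left]
  simp

open Classical in
theorem rightTranslate_single (α : List ι) :
    rightTranslate α (lp.single 2 [] 1) = lp.single 2 α 1 := by
  ext x
  by_cases h : α <:+ x
  · obtain ⟨y, rfl⟩ := h
    rw [rightTranslate_append]
    by_cases hy : y = []
    · subst hy; simp
    · rw [lp.single_apply_ne _ _ _ hy, lp.single_apply_ne]
      simpa using hy
  · rw [rightTranslate_eq_zero _ _ h, lp.single_apply_ne]
    rintro rfl
    exact h List.suffix_rfl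

/-- Translated vacua form the standard basis. This yields both totality of the shift and continuity
of coefficients. -/
theorem inner_columnTranslate_vacuum (k : κ) (α : List ι)
    (g : lp (fun _ : κ => FockSpace ι) 2) :
    inner ℂ (columnTranslate κ α (vacuum ι κ k)) g = g k α := by
  classical
  have : columnTranslate κ α (vacuum ι κ k) = lp.single 2 k (lp.single 2 α 1) := by
    ext1
    funext l
    rw [columnTranslate_apply, vacuum]
    by_cases h : l = k
    · subst h
      rw [lp.single_apply_self, lp.single_apply_self, rightTranslate_single]
    · rw [lp.single_apply_ne _ _ _ h, lp.single_apply_ne _ _ _ h, map_zero]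
  rw [this, lp.inner_single_left, lp.inner_single_left]
  simp

theorem isShift_columnTranslate (ι κ : Type*) :
    IsShift (columnTranslate (ι := ι) κ) (Set.range (vacuum ι κ)) where
  nil g := by
    ext1; funext k
    rw [columnTranslate_apply, rightTranslate_nil]
  append α β g := by
    ext1; funext k
    simp only [columnTranslate_apply, rightTranslate_comp]
  orthogonal i j hij f g := by
    rw [lp.inner_eq_tsum]
    simp [columnTranslate_apply, inner_rightTranslate_of_ne hij]
  vacuum := by
    rintro _ ⟨k, rfl⟩ j g
    rw [inner_vacuum_left, columnTranslate_apply, rightTranslate_eq_zero]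
    rintro ⟨z, hz⟩
    simp at hz
  total g hg := by
    ext1; funext k
    ext α
    rw [← inner_columnTranslate_vacuum, hg _ ⟨k, rfl⟩]
    simp

/-- Only suffixes `β` of `γ` contribute, and these are the finitely many `γ.drop k`, distinguished
by their lengths. This is what identifies `wanderingIsometry` with left multiplication. -/
theorem hasSum_mul_rightTranslate {F G : FockSpace ι} {γ : List ι} :
    HasSum (fun β => G β * rightTranslate β F γ) (cauchyProd F G γ) := by
  classical
  have hinj : Set.InjOn (fun k => γ.drop k) (Finset.range (γ.length + 1)) := by
    intro a ha b hb h
    have := congrArg List.length h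
    simp at this ha hb
    omega
  have h1 : cauchyProd F G γ =
      ∑ β ∈ (Finset.range (γ.length + 1)).image (fun k => γ.drop k),
        G β * rightTranslate β F γ := by
    rw [Finset.sum_image hinj, cauchyProd]
    refine Finset.sum_congr rfl fun k _ => ?_
    have := rightTranslate_append (γ.drop k) F (γ.take k)
    rw [List.take_append_drop] at this
    rw [this, mul_comm]
  rw [h1]
  refine hasSum_sum_of_ne_finset_zero fun β hβ => ?_
  rw [rightTranslate_eq_zero, mul_zero]
  rintro ⟨z, rfl⟩
  refine hβ (Finset.mem_image.2 ⟨z.length, ?_, ?_⟩)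
  · simp
  · simp

/-- Pointwise coefficients are continuous on a direct sum of Fock spaces. -/
theorem HasSum.coeff {f : List ι → lp (fun _ : κ => FockSpace ι) 2}
    {g : lp (fun _ : κ => FockSpace ι) 2} (h : HasSum f g) (k : κ) (γ : List ι) :
    HasSum (fun β => f β k γ) (g k γ) := by
  have := h.mapL (innerSL ℂ (columnTranslate κ γ (vacuum ι κ k)))
  simpa only [innerSL_apply_apply, inner_columnTranslate_vacuum] using this

theorem wanderingIsometry_apply {φ : lp (fun _ : κ => FockSpace ι) 2}
    (h : Orthonormal ℂ fun α => columnTranslate κ α φ) (G : FockSpace ι) (k : κ) :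
    (wanderingIsometry h G k : FreeSeries ι) = cauchyProd (φ k) G := by
  funext γ
  refine (HasSum.coeff (hasSum_wanderingIsometry h G) k γ).unique ?_
  simpa [columnTranslate_apply] using hasSum_mul_rightTranslate (F := φ k) (G := G) (γ := γ)

end Translation

end FreeFock

namespace FreeFock

open scoped Matrix.Norms.L2Operator
open scoped ENNReal

/-! ### Re-indexing sums over words. -/

section Words

variable {ι : Type*}

/-- A word is either empty or has a last letter. -/
def snocEquiv (ι : Type*) : Unit ⊕ (List ι × ι) ≃ List ι where
  toFun o := o.elim (fun _ => []) fun p => p.1 ++ [p.2]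
  invFun α := if h : α = [] then .inl () else .inr (α.dropLast, α.getLast h)
  left_inv o := by cases o <;> simp
  right_inv α := by
    by_cases h : α = []
    · simp [h]
    · simp [h, List.dropLast_append_getLast]

/-- Factorizations of a word into two words. -/
def splitEquiv (ι : Type*) : List ι × List ι ≃ Σ α : List ι, Fin (α.length + 1) where
  toFun p := ⟨p.1 ++ p.2, ⟨p.1.length, by simp⟩⟩
  invFun q := (q.1.take q.2, q.1.drop q.2)
  left_inv p := by simp
  right_inv q := by
    obtain ⟨α, k, hk⟩ := q
    ext1
    · simp
    · simp only
      refine (Fin.heq_ext_iff (by simp)).2 ?_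
      simp; omega

theorem tsum_snoc (f : List ι → ℝ≥0∞) :
    ∑' α, f α = f [] + ∑' α, ∑' j, f (α ++ [j]) := by
  rw [← (snocEquiv ι).tsum_eq f, ENNReal.summable.tsum_sum ENNReal.summable, ← ENNReal.tsum_prod,
    tsum_fintype, Finset.univ_unique, Finset.sum_singleton]
  rfl

theorem HasSum.snoc {f : List ι → ℝ} {a : ℝ} (h : HasSum f a) :
    HasSum (fun p : List ι × ι => f (p.1 ++ [p.2])) (a - f []) := by
  have h1 := (snocEquiv ι).hasSum_iff.2 h
  have h2 : HasSum (fun p : List ι × ι => f (p.1 ++ [p.2]))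
      (∑' p : List ι × ι, f (p.1 ++ [p.2])) :=
    (h1.summable.comp_injective Sum.inr_injective).hasSum
  have h3 : HasSum (fun _ : Unit => f []) (f []) := hasSum_unique _
  have h4 := (HasSum.sum (f := f ∘ snocEquiv ι) h3 h2).unique h1
  rw [← h4, add_sub_cancel_left]
  exact h2

end Words

/-! ### Absolute convergence and multiplicativity of evaluation on the ball. -/

section Ball

variable {ι : Type*} {n : ℕ} (X : ι → Matrix (Fin n) (Fin n) ℂ)

/-- The vector `(X^α)^* y`. -/
noncomputable def adjWord (α : List ι) (y : EuclideanSpace ℂ (Fin n)) :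
    EuclideanSpace ℂ (Fin n) :=
  WithLp.toLp 2 ((wordEval X α).conjTranspose.mulVec y)

theorem wordEval_append (α β : List ι) :
    wordEval X (α ++ β) = wordEval X α * wordEval X β := by
  simp [wordEval]

theorem adjWord_nil (y : EuclideanSpace ℂ (Fin n)) : adjWord X [] y = y := by
  simp [adjWord, wordEval]

theorem adjWord_append (α β : List ι) (y : EuclideanSpace ℂ (Fin n)) :
    adjWord X (α ++ β) y = adjWord X β (adjWord X α y) := by
  simp [adjWord, wordEval_append, Matrix.conjTranspose_mul]

theorem norm_mulVec_sq {m : ℕ} (M : Matrix (Fin m) (Fin n) ℂ) (y : Fin n → ℂ) :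
    ‖WithLp.toLp 2 (M.mulVec y)‖ ^ 2 = (star y ⬝ᵥ (M.conjTranspose * M).mulVec y).re := by
  rw [EuclideanSpace.norm_sq_eq, ← Matrix.mulVec_mulVec, Matrix.dotProduct_mulVec,
    ← Matrix.star_mulVec, dotProduct, Complex.re_sum]
  refine Finset.sum_congr rfl fun i _ => ?_
  rw [Pi.star_apply, RCLike.star_def, Complex.conj_mul']
  norm_cast

variable {X}

theorem hasSum_adjWord_letter (hX : X ∈ freeBall ι n) (y : EuclideanSpace ℂ (Fin n)) :
    HasSum (fun j => ‖adjWord X [j] y‖ ^ 2)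
      (star y.ofLp ⬝ᵥ (∑' j, X j * (X j).conjTranspose).mulVec y.ofLp).re := by
  let L : Matrix (Fin n) (Fin n) ℂ →ₗ[ℝ] ℝ :=
    { toFun := fun M => (star y.ofLp ⬝ᵥ M.mulVec y.ofLp).re
      map_add' := fun M N => by simp [Matrix.add_mulVec]
      map_smul' := fun c M => by simp [Matrix.smul_mulVec] }
  have := hX.1.hasSum.map L (LinearMap.continuous_of_finiteDimensional L)
  change HasSum _ (L _)
  convert this using 1
  funext j
  simp only [adjWord, norm_mulVec_sq, Function.comp_apply, wordEval, List.map_cons, List.map_nil,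
    List.prod_singleton, Matrix.conjTranspose_conjTranspose]
  rfl

theorem re_dotProduct_le (M : Matrix (Fin n) (Fin n) ℂ) (y : EuclideanSpace ℂ (Fin n)) :
    (star y.ofLp ⬝ᵥ M.mulVec y.ofLp).re ≤ ‖M‖ * ‖y‖ ^ 2 := by
  have h1 : star y.ofLp ⬝ᵥ M.mulVec y.ofLp = inner ℂ y (WithLp.toLp 2 (M.mulVec y.ofLp)) := by
    rw [EuclideanSpace.inner_eq_star_dotProduct, dotProduct_comm]
  rw [h1]
  calc _ ≤ ‖y‖ * ‖WithLp.toLp 2 (M.mulVec y.ofLp)‖ := re_inner_le_norm (𝕜 := ℂ) _ _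
    _ ≤ ‖y‖ * (‖M‖ * ‖y‖) := by
      gcongr
      exact M.l2_opNorm_mulVec y
    _ = _ := by ring

/-- Appending one letter multiplies the total mass by at most `r < 1`, so the sum is dominated by a
geometric series. -/
theorem summable_adjWord (hX : X ∈ freeBall ι n) (y : EuclideanSpace ℂ (Fin n)) :
    Summable fun α => ‖adjWord X α y‖ ^ 2 := by
  set r := ‖∑' j, X j * (X j).conjTranspose‖ with hr
  have hr1 : r < 1 := hX.2
  have hr0 : 0 ≤ r := norm_nonneg _
  -- The fixed point of `t ↦ ‖y‖² + r t`, the recursion obeyed by the bounds on sums over words of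
  -- length at most `N`.
  set b : ℝ≥0∞ := ENNReal.ofReal (‖y‖ ^ 2 / (1 - r)) with hb
  have hstep : ∀ z : EuclideanSpace ℂ (Fin n),
      ∑' j, ENNReal.ofReal (‖adjWord X [j] z‖ ^ 2) ≤
        ENNReal.ofReal r * ENNReal.ofReal (‖z‖ ^ 2) := by
    intro z
    have h := hasSum_adjWord_letter hX z
    rw [← ENNReal.ofReal_tsum_of_nonneg (fun _ => by positivity) h.summable, h.tsum_eq,
      ← ENNReal.ofReal_mul hr0]
    exact ENNReal.ofReal_le_ofReal (re_dotProduct_le _ _)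
  have hbound : ∀ N : ℕ, ∑' α : List ι,
      (if α.length ≤ N then ENNReal.ofReal (‖adjWord X α y‖ ^ 2) else 0) ≤ b := by
    have hbb : ENNReal.ofReal (‖y‖ ^ 2) + ENNReal.ofReal r * b ≤ b := by
      rw [hb, ← ENNReal.ofReal_mul hr0, ← ENNReal.ofReal_add (by positivity)
        (mul_nonneg hr0 (div_nonneg (by positivity) (by linarith)))]
      refine ENNReal.ofReal_le_ofReal (le_of_eq ?_)
      have : 1 - r ≠ 0 := by linarith
      field_simp
      ring
    intro N
    induction N with
    | zero =>
      rw [tsum_snoc]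
      simp only [List.length_nil, le_refl, if_true, List.length_append, List.length_singleton,
        Nat.le_zero, Nat.add_eq_zero_iff, one_ne_zero, and_false, if_false, tsum_zero, add_zero,
        adjWord_nil]
      exact le_trans le_self_add hbb
    | succ N ih =>
      rw [tsum_snoc]
      refine le_trans (add_le_add (le_of_eq (by simp [adjWord_nil])) ?_) hbb
      refine le_trans ?_ (mul_le_mul_right ih _)
      rw [← ENNReal.tsum_mul_left]
      refine ENNReal.tsum_le_tsum fun α => ?_
      by_cases h : α.length ≤ N
      · simp only [List.length_append, List.length_singleton, Nat.add_le_add_iff_right, h,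
          if_true, adjWord_append]
        exact hstep _
      · simp [h]
  have hfin : ∑' α, ENNReal.ofReal (‖adjWord X α y‖ ^ 2) ≤ b := by
    rw [ENNReal.tsum_eq_iSup_sum]
    refine iSup_le fun s => ?_
    refine le_trans ?_ (hbound (s.sup List.length))
    refine le_trans (le_of_eq (Finset.sum_congr rfl fun α hα => ?_)) (ENNReal.sum_le_tsum s)
    rw [if_pos (Finset.le_sup hα)]
  have := ENNReal.summable_toReal (ne_top_of_le_ne_top ENNReal.ofReal_ne_top hfin)
  simpa using this

/-- Absolute convergence, over all words, of square-summable series on the free ball. -/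
theorem summable_norm_smul_wordEval (hX : X ∈ freeBall ι n) (F : FockSpace ι) :
    Summable fun α => ‖F α • wordEval X α‖ := by
  -- In finite dimension it suffices to treat each entry. The `(p, q)` entry of `X^α` is the
  -- conjugate of coordinate `q` of `(X^α)^* e_p`, and `ab ≤ a² + b²` for `a, b ≥ 0`.
  rw [summable_norm_iff]
  refine Pi.summable.2 fun p => Pi.summable.2 fun q => ?_
  refine Summable.of_norm_bounded
    ((summable_norm_sq F).add (summable_adjWord hX (EuclideanSpace.single p 1))) fun α => ?_
  have h1 : ‖wordEval X α p q‖ ≤ ‖adjWord X α (EuclideanSpace.single p 1)‖ := by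
    have := PiLp.norm_apply_le (adjWord X α (EuclideanSpace.single p 1)) q
    simpa [adjWord] using this
  have h2 : ‖(F α • wordEval X α) p q‖ = ‖F α‖ * ‖wordEval X α p q‖ := by
    rw [Matrix.smul_apply, norm_smul]
  rw [h2]
  nlinarith [norm_nonneg (F α), norm_nonneg (wordEval X α p q),
    sq_nonneg (‖F α‖ - ‖wordEval X α p q‖),
    pow_le_pow_left₀ (norm_nonneg (wordEval X α p q)) h1 2,
    sq_nonneg (‖wordEval X α p q‖), sq_nonneg ‖F α‖]

theorem eval_eq_tsum {F : FreeSeries ι} (h : Summable fun α => F α • wordEval X α) :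
    eval F X = ∑' α, F α • wordEval X α := by
  rw [← (Equiv.sigmaFiberEquiv (List.length (α := ι))).tsum_eq]
  exact (Summable.tsum_sigma ((Equiv.sigmaFiberEquiv _).summable_iff.2 h)).symm

theorem isFreeHolomorphic_fock (F : FockSpace ι) : IsFreeHolomorphic (F : FreeSeries ι) := by
  intro n X hX
  have h := (Equiv.sigmaFiberEquiv (List.length (α := ι))).summable_iff.2
    (summable_norm_smul_wordEval hX F)
  have h1 : ∀ k, Summable fun α : {α : List ι // α.length = k} => ‖F α.1 • wordEval X α.1‖ :=
    fun k => h.sigma_factor k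
  refine ⟨fun k => (h1 k).of_norm, ?_⟩
  exact Summable.of_nonneg_of_le (fun _ => norm_nonneg _)
    (fun k => norm_tsum_le_tsum_norm (h1 k)) h.sigma

theorem tsum_word_mul {R : Type*} [NormedRing R] [CompleteSpace R] {f g : List ι → R}
    (hf : Summable fun α => ‖f α‖) (hg : Summable fun α => ‖g α‖) :
    (∑' α, f α) * ∑' α, g α =
      ∑' α : List ι, ∑ k ∈ Finset.range (α.length + 1), f (α.take k) * g (α.drop k) := by
  have h1 : HasSum (fun p : List ι × List ι => f p.1 * g p.2) ((∑' α, f α) * ∑' α, g α) := by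
    rw [tsum_mul_tsum_of_summable_norm hf hg]
    exact (summable_mul_of_summable_norm hf hg).hasSum
  have h2 := (splitEquiv ι).symm.hasSum_iff.2 h1
  refine (HasSum.tsum_eq (h2.sigma fun α => ?_)).symm
  rw [← Fin.sum_univ_eq_sum_range (fun k => f (α.take k) * g (α.drop k))]
  exact hasSum_fintype _

theorem eval_mul_eval (hX : X ∈ freeBall ι n) {F G K : FockSpace ι}
    (h : (K : FreeSeries ι) = cauchyProd F G) :
    eval (F : FreeSeries ι) X * eval (G : FreeSeries ι) X = eval (K : FreeSeries ι) X := by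
  have hF := summable_norm_smul_wordEval hX F
  have hG := summable_norm_smul_wordEval hX G
  rw [eval_eq_tsum hF.of_norm, eval_eq_tsum hG.of_norm,
    eval_eq_tsum (summable_norm_smul_wordEval hX K).of_norm, tsum_word_mul hF hG]
  refine tsum_congr fun α => ?_
  rw [h, cauchyProd, Finset.sum_smul]
  refine Finset.sum_congr rfl fun k _ => ?_
  rw [smul_mul_smul_comm, ← wordEval_append, List.take_append_drop]

end Ball

end FreeFock

namespace FreeFock

open scoped Matrix.Norms.L2Operator

/-! ### Poisson kernel and boundedness of multipliers on the ball. -/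

section Poisson

variable {ι : Type*} {n : ℕ} {X : ι → Matrix (Fin n) (Fin n) ℂ}

open scoped ComplexOrder MatrixOrder in
theorem exists_defect (hX : X ∈ freeBall ι n) :
    ∃ D : Matrix (Fin n) (Fin n) ℂ,
      D.conjTranspose * D = 1 - ∑' j, X j * (X j).conjTranspose := by
  set Q := ∑' j, X j * (X j).conjTranspose with hQ
  have hherm : Q.IsHermitian := by
    change star Q = Q
    rw [hQ, tsum_star]
    refine tsum_congr fun j => ?_
    rw [star_mul, ← Matrix.star_eq_conjTranspose, star_star]
  have hpos : (1 - Q).PosSemidef := by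
    have hh : (1 - Q).IsHermitian := Matrix.isHermitian_one.sub hherm
    refine Matrix.PosSemidef.of_dotProduct_mulVec_nonneg hh fun y => ?_
    rw [Complex.nonneg_iff]
    constructor
    · have h1 := re_dotProduct_le Q (WithLp.toLp 2 y)
      have h2 : (star y ⬝ᵥ (1 : Matrix (Fin n) (Fin n) ℂ).mulVec y).re =
          ‖(WithLp.toLp 2 y : EuclideanSpace ℂ (Fin n))‖ ^ 2 := by
        have := norm_mulVec_sq (1 : Matrix (Fin n) (Fin n) ℂ) y
        rw [Matrix.conjTranspose_one, one_mul] at this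
        rw [← this, Matrix.one_mulVec]
      have h3 : ‖Q‖ < 1 := hX.2
      rw [Matrix.sub_mulVec, dotProduct_sub, Complex.sub_re, h2]
      simp only at h1
      nlinarith [sq_nonneg ‖(WithLp.toLp 2 y : EuclideanSpace ℂ (Fin n))‖]
    · exact (hh.im_star_dotProduct_mulVec_self y).symm
  obtain ⟨D, hD⟩ := CStarAlgebra.nonneg_iff_eq_star_mul_self.mp hpos.nonneg
  exact ⟨D, hD.symm⟩

theorem norm_defect_sq {D : Matrix (Fin n) (Fin n) ℂ}
    (hD : D.conjTranspose * D = 1 - ∑' j, X j * (X j).conjTranspose)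
    (y : EuclideanSpace ℂ (Fin n)) :
    ‖WithLp.toLp 2 (D.mulVec y.ofLp)‖ ^ 2 = ‖y‖ ^ 2 -
      (star y.ofLp ⬝ᵥ (∑' j, X j * (X j).conjTranspose).mulVec y.ofLp).re := by
  have := norm_mulVec_sq (1 : Matrix (Fin n) (Fin n) ℂ) y.ofLp
  rw [Matrix.conjTranspose_one, one_mul, Matrix.one_mulVec] at this
  rw [norm_mulVec_sq, hD, Matrix.sub_mulVec, dotProduct_sub, Complex.sub_re, Matrix.one_mulVec,
    ← this]

/-- The term at `α` is `‖(X^α)^* y‖²` minus the sum of the same quantity over all one-letter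
extensions `αj`. The total telescopes to the empty word, so the Poisson kernel is isometric. -/
theorem hasSum_norm_defect_sq (hX : X ∈ freeBall ι n) {D : Matrix (Fin n) (Fin n) ℂ}
    (hD : D.conjTranspose * D = 1 - ∑' j, X j * (X j).conjTranspose)
    (y : EuclideanSpace ℂ (Fin n)) :
    HasSum (fun α => ‖WithLp.toLp 2 (D.mulVec (adjWord X α y).ofLp)‖ ^ 2) (‖y‖ ^ 2) := by
  have h := (summable_adjWord hX y).hasSum
  have h1 := HasSum.snoc h
  simp only [adjWord_append] at h1
  have h2 := h.sub (h1.prod_fiberwise fun α => hasSum_adjWord_letter hX (adjWord X α y))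
  rw [adjWord_nil, sub_sub_cancel] at h2
  simpa only [norm_defect_sq hD] using h2

/-- The coordinates of the Poisson kernel of a point of the free ball. -/
noncomputable def poisson (hX : X ∈ freeBall ι n) {D : Matrix (Fin n) (Fin n) ℂ}
    (hD : D.conjTranspose * D = 1 - ∑' j, X j * (X j).conjTranspose) (i : Fin n)
    (y : EuclideanSpace ℂ (Fin n)) : FockSpace ι :=
  ⟨fun α => D.mulVec (adjWord X α y).ofLp i, memℓp_two (by
    refine Summable.of_nonneg_of_le (fun _ => by positivity) (fun α => ?_)
      (hasSum_norm_defect_sq hX hD y).summable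
    gcongr
    exact PiLp.norm_apply_le (WithLp.toLp 2 (D.mulVec (adjWord X α y).ofLp)) i)⟩

theorem sum_norm_poisson_sq (hX : X ∈ freeBall ι n) {D : Matrix (Fin n) (Fin n) ℂ}
    (hD : D.conjTranspose * D = 1 - ∑' j, X j * (X j).conjTranspose)
    (y : EuclideanSpace ℂ (Fin n)) : ∑ i, ‖poisson hX hD i y‖ ^ 2 = ‖y‖ ^ 2 := by
  rw [← (hasSum_norm_defect_sq hX hD y).tsum_eq]
  simp only [EuclideanSpace.norm_sq_eq, norm_sq_eq_tsum]
  exact (Summable.tsum_finsetSum fun i _ => summable_norm_sq (poisson hX hD i y)).symm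

open Classical in
theorem cauchyProd_single (F : FockSpace ι) (β : List ι) :
    cauchyProd F (lp.single 2 β (1 : ℂ) : FockSpace ι) = rightTranslate β F := by
  funext γ
  refine (hasSum_mul_rightTranslate (F := F) (G := lp.single 2 β 1)).unique ?_
  convert hasSum_single β fun β' h => ?_ using 1
  · simp
  · rw [lp.single_apply_ne _ _ _ h, zero_mul]

theorem inner_rightTranslate (F K : FockSpace ι) (β : List ι) :
    HasSum (fun γ => inner ℂ (F γ) (K (γ ++ β))) (inner ℂ (rightTranslate β F) K) := by
  have h := lp.hasSum_inner (𝕜 := ℂ) (rightTranslate β F) K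
  rw [← (List.append_left_injective β).hasSum_iff] at h
  · simpa only [Function.comp_def, rightTranslate_append] using h
  · intro x hx
    rw [rightTranslate_eq_zero _ _ hx, inner_zero_left]

/-- The Poisson kernel intertwines `F(X)^*` with `M^*`. Testing on `e_β`, whose image under `M` is
the right translate of `F`, gives the sum over `γ` of `conj F_γ` times the kernel coefficient at
`γβ`. -/
theorem adjoint_poisson (hX : X ∈ freeBall ι n) {D : Matrix (Fin n) (Fin n) ℂ}
    (hD : D.conjTranspose * D = 1 - ∑' j, X j * (X j).conjTranspose) (i : Fin n)
    (y : EuclideanSpace ℂ (Fin n)) {F : FockSpace ι} {M : FockSpace ι →L[ℂ] FockSpace ι}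
    (hM : ∀ G : FockSpace ι, (M G : FreeSeries ι) = cauchyProd F G) :
    ContinuousLinearMap.adjoint M (poisson hX hD i y) =
      poisson hX hD i (WithLp.toLp 2 ((eval (F : FreeSeries ι) X).conjTranspose.mulVec y.ofLp)) := by
  classical
  ext β
  have h1 : ContinuousLinearMap.adjoint M (poisson hX hD i y) β =
      inner ℂ (rightTranslate β F) (poisson hX hD i y) := by
    have h2 : M (lp.single 2 β 1) = rightTranslate β F := by
      ext1
      exact (hM _).trans (cauchyProd_single F β)
    rw [← h2, ← ContinuousLinearMap.adjoint_inner_right, lp.inner_single_left]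
    simp
  rw [h1]
  refine (inner_rightTranslate F _ β).unique ?_
  -- The conjugate transpose makes this map only real-linear; that still gives the continuity needed
  -- to pass through the sum.
  let L : Matrix (Fin n) (Fin n) ℂ →ₗ[ℝ] ℂ :=
    { toFun := fun N => D.mulVec (adjWord X β
        (WithLp.toLp 2 (N.conjTranspose.mulVec y.ofLp))).ofLp i
      map_add' := fun N N' => by
        simp [adjWord, Matrix.add_mulVec, Matrix.mulVec_add, Matrix.conjTranspose_add]
      map_smul' := fun c N => by
        simp [adjWord, Matrix.smul_mulVec, Matrix.mulVec_smul, Matrix.conjTranspose_smul] }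
  have hs := (summable_norm_smul_wordEval hX F).of_norm
  have h3 := hs.hasSum.map L (LinearMap.continuous_of_finiteDimensional L)
  rw [← eval_eq_tsum hs] at h3
  change HasSum _ (L _)
  convert h3 using 1
  funext γ
  change inner ℂ (F γ) (D.mulVec (adjWord X (γ ++ β) y).ofLp i) = L (F γ • wordEval X γ)
  simp [L, wordEval_append, adjWord, Matrix.conjTranspose_smul, Matrix.smul_mulVec, mul_comm,
    Matrix.conjTranspose_mul]

/-- A von Neumann inequality: the kernel is isometric and carries `F(X)^*` to `M^*`, so `‖F(X)^* y‖
≤ ‖M^*‖ ‖y‖`. -/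
theorem norm_eval_le (hX : X ∈ freeBall ι n) {F : FockSpace ι}
    {M : FockSpace ι →L[ℂ] FockSpace ι}
    (hM : ∀ G : FockSpace ι, (M G : FreeSeries ι) = cauchyProd F G) :
    ‖eval (F : FreeSeries ι) X‖ ≤ ‖M‖ := by
  obtain ⟨D, hD⟩ := exists_defect hX
  rw [← Matrix.l2_opNorm_conjTranspose, Matrix.l2_opNorm_def]
  refine ContinuousLinearMap.opNorm_le_bound _ (norm_nonneg _) fun y => ?_
  change ‖(WithLp.toLp 2 ((eval (F : FreeSeries ι) X).conjTranspose.mulVec y.ofLp) :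
    EuclideanSpace ℂ (Fin n))‖ ≤ _
  rw [← sq_le_sq₀ (norm_nonneg _) (by positivity), ← sum_norm_poisson_sq hX hD, mul_pow,
    ← sum_norm_poisson_sq hX hD y, Finset.mul_sum]
  refine Finset.sum_le_sum fun i _ => ?_
  rw [← adjoint_poisson hX hD i y hM, ← mul_pow]
  gcongr
  rw [← ContinuousLinearMap.adjoint.norm_map M]
  exact ContinuousLinearMap.le_opNorm _ _

theorem isBoundedFree_of_multiplier {F : FockSpace ι} {M : FockSpace ι →L[ℂ] FockSpace ι}
    (hM : ∀ G : FockSpace ι, (M G : FreeSeries ι) = cauchyProd F G) :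
    IsBoundedFree (F : FreeSeries ι) :=
  ⟨isFreeHolomorphic_fock F, ‖M‖, fun _ _ hX => norm_eval_le hX hM⟩

end Poisson

end FreeFock

namespace FreeFock

/-! ### The column `(1, H₁, H₂, …)` and the factorization. -/

section Main

variable {ι : Type*}

theorem HasSum.option {f : Option ℕ → ℝ} {a : ℝ} (h : HasSum (fun i => f (some i)) a) :
    HasSum f (f none + a) := by
  rw [← (Equiv.optionEquivSumPUnit.{0} ℕ).symm.hasSum_iff, add_comm]
  exact HasSum.sum (f := f ∘ (Equiv.optionEquivSumPUnit.{0} ℕ).symm) h (hasSum_unique _)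

open Classical in
/-- The constant series `1`. -/
noncomputable def fockOne (ι : Type*) : FockSpace ι := lp.single 2 [] 1

theorem norm_fockOne : ‖fockOne ι‖ = 1 := by
  classical
  simp [fockOne, lp.norm_single]

theorem eval_fockOne {n : ℕ} {X : ι → Matrix (Fin n) (Fin n) ℂ} :
    eval (fockOne ι : FreeSeries ι) X = 1 := by
  classical
  have h : HasSum (fun α => fockOne ι α • wordEval X α) (fockOne ι [] • wordEval X []) :=
    hasSum_single [] fun α hα => by
      rw [fockOne, lp.single_apply_ne _ _ _ hα, zero_smul]
  rw [eval_eq_tsum h.summable, h.tsum_eq]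
  simp [fockOne, wordEval]

/-- The column `(1, H₁, H₂, …)`. -/
noncomputable def graphColumn (H : ℕ → FockSpace ι) (hH : Summable fun i => ‖H i‖ ^ 2) :
    lp (fun _ : Option ℕ => FockSpace ι) 2 :=
  ⟨fun k => k.elim (fockOne ι) H,
    memℓp_two (HasSum.option (f := fun k => ‖k.elim (fockOne ι) H‖ ^ 2) hH.hasSum).summable⟩

theorem norm_graphColumn_sq (H : ℕ → FockSpace ι) (hH : Summable fun i => ‖H i‖ ^ 2) :
    ‖graphColumn H hH‖ ^ 2 = 1 + ∑' i, ‖H i‖ ^ 2 := by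
  have := (HasSum.option (f := fun k => ‖k.elim (fockOne ι) H‖ ^ 2) hH.hasSum).tsum_eq
  rw [norm_sq_eq_tsum]
  refine this.trans ?_
  simp [norm_fockOne]

/-- A coordinate of an isometry into a direct sum, as a bounded operator. -/
noncomputable def coordOp {κ : Type*} (V : FockSpace ι →ₗᵢ[ℂ] lp (fun _ : κ => FockSpace ι) 2)
    (k : κ) : FockSpace ι →L[ℂ] FockSpace ι :=
  (lp.evalCLM ℂ (fun _ : κ => FockSpace ι) 2 k).comp V.toContinuousLinearMap

/-- The translates of `1` are the monomials, so the range contains all finite truncations of `g`. -/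
theorem denseRange_of_rightTranslate {M : FockSpace ι →L[ℂ] FockSpace ι}
    (h : ∀ α, rightTranslate α (fockOne ι) ∈ Set.range M) : DenseRange M := by
  classical
  intro g
  refine mem_closure_of_tendsto (lp.hasSum_single (p := 2) (by norm_num) g)
    (Filter.Eventually.of_forall fun s => ?_)
  change _ ∈ LinearMap.range (M : FockSpace ι →ₗ[ℂ] FockSpace ι)
  refine Submodule.sum_mem _ fun α _ => ?_
  have h1 : lp.single 2 α (g α) = g α • rightTranslate α (fockOne ι) := by
    rw [fockOne, rightTranslate_single, ← lp.single_smul, smul_eq_mul, mul_one]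
  rw [h1]
  exact Submodule.smul_mem _ _ (h α)

end Main

end FreeFock

theorem mainTheorem3 {ι : Type*} [Countable ι] (H : ℕ → FreeFock.FockSpace ι)
    (hH : Summable (fun i => ‖H i‖ ^ 2)) :
    ∃ (A : FreeFock.FreeSeries ι) (B : ℕ → FreeFock.FreeSeries ι),
      FreeFock.IsLeftOuter A ∧
      (∀ (n : ℕ), ∀ X ∈ FreeFock.freeBall ι n,
        IsUnit (FreeFock.eval A X) ∧
          ∀ i, FreeFock.eval (⇑(H i)) X = FreeFock.eval (B i) X * (FreeFock.eval A X)⁻¹) ∧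
      FreeFock.IsIsometricLeftColumn (fun k : Option ℕ => k.elim A B) ∧
      (∃ C : FreeFock.FockSpace ι,
        (∀ (n : ℕ), ∀ X ∈ FreeFock.freeBall ι n,
          FreeFock.eval (⇑C) X = (FreeFock.eval A X)⁻¹) ∧
        ‖C‖ ^ 2 = 1 + ∑' i, ‖H i‖ ^ 2) := by
  classical
  open FreeFock in
  set h := graphColumn H hH with hh
  have hT := isShift_columnTranslate ι (Option ℕ)
  obtain ⟨φ, hφ, hle⟩ := hT.exists_wandering h
    ⟨vacuum ι _ none, ⟨none, rfl⟩, by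
      rw [inner_vacuum_left]
      change fockOne ι [] ≠ 0
      simp [fockOne]⟩
  set V := wanderingIsometry hφ with hV
  have hVk : ∀ G k, (V G k : FreeSeries ι) = cauchyProd (φ k) G := wanderingIsometry_apply hφ
  have hmem : ∀ α, ∃ G, V G = columnTranslate (Option ℕ) α h := fun α =>
    closure_span_le_range hφ (hle (subset_closure_span ⟨α, rfl⟩))
  have hbdd : ∀ k, IsBoundedFree (φ k : FreeSeries ι) := fun k =>
    isBoundedFree_of_multiplier (M := coordOp V k) fun G => hVk G k
  -- The preimage of `h` itself: its coordinates read `AC = 1` and `B_i C = H_i`.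
  obtain ⟨C, hC⟩ := hmem []
  rw [hT.nil] at hC
  have hAC : ∀ n, ∀ X ∈ freeBall ι n, eval (φ none : FreeSeries ι) X * eval C X = 1 := by
    intro n X hX
    rw [eval_mul_eval hX (K := V C none) (hVk C none), hC]
    exact eval_fockOne
  have hBC : ∀ n, ∀ X ∈ freeBall ι n, ∀ i,
      eval (φ (some i) : FreeSeries ι) X * eval C X = eval (H i : FreeSeries ι) X := by
    intro n X hX i
    rw [eval_mul_eval hX (K := V C (some i)) (hVk C (some i)), hC]
    rfl
  have hinv : ∀ n, ∀ X ∈ freeBall ι n,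
      eval (C : FreeSeries ι) X = (eval (φ none : FreeSeries ι) X)⁻¹ := fun n X hX =>
    (Matrix.inv_eq_right_inv (hAC n X hX)).symm
  have helim : ∀ k : Option ℕ, (k.elim (φ none : FreeSeries ι) fun i => φ (some i)) = φ k := by
    intro k
    cases k <;> rfl
  refine ⟨φ none, fun i => φ (some i), ⟨hbdd none, coordOp V none, fun G => hVk G none, ?_⟩,
    fun n X hX => ⟨?_, fun i => ?_⟩, ⟨fun k => ?_, V, fun G k => ?_⟩, C, hinv, ?_⟩
  -- The `none` entry of the translate of `h` by `α` is the translate of `1`, hence lies in the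
  -- range of multiplication by `A`.
  · refine denseRange_of_rightTranslate fun α => ?_
    obtain ⟨G, hG⟩ := hmem α
    refine ⟨G, ?_⟩
    change V G none = _
    rw [hG]
    rfl
  · exact IsUnit.of_mul_eq_one _ (hAC n X hX)
  · rw [← hinv n X hX, hBC n X hX i]
  · simp only [helim]
    exact hbdd k
  · simp only [helim]
    exact hVk G k
  · rw [← norm_graphColumn_sq H hH, ← hh, ← hC, V.norm_map]
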